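/- For $\alpha>0$, a finite simple graph $G$ on $n$ vertices is called $\alpha$-expanding if every set $X$ of at most $n/2$ vertices satisfies $|N_G(X)|\ge \alpha|X|$, where $N_G(X)$ is the set of vertices outside $X$ that have a neighbor in $X$. There are absolute constants $c>0$, $\alpha_0>0$ and $\Delta\in\mathbb{N}$ with the following property. For every integer $k>1$ with smallest prime divisor $p$ and every $\alpha\in\left(0,\frac{c}{p-1}\right)$, there are arbitrarily large $\alpha$-expanding graphs in which every cycle has length divisible by $p$. In particular, these graphs contain no cycle of length congruent to $r$ modulo $k$, for any $r$ not divisible by $p$ (for instance, $r=1$). Moreover, each of these graphs can be taken to be obtained from an $\alpha_0$-expanding graph of maximum degree at most $\Delta$ by subdividing every edge exactly $p-1$ times, that is, by replacing every edge by a path of length $p$. -/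

import Mathlib

/-- The external neighborhood `N_G(X)`: the vertices outside `X` that have a neighbor in `X`. -/
def SimpleGraph.extNeighborhood {V : Type*} (G : SimpleGraph V) (X : Set V) : Set V :=
  {v | v ∉ X ∧ ∃ u ∈ X, G.Adj u v}

/-- A finite graph `G` on `n` vertices is `α`-expanding if `|N_G(X)| ≥ α |X|` for every set `X`
of at most `n / 2` vertices. -/
def SimpleGraph.IsExpanding {V : Type*} [Fintype V] (G : SimpleGraph V) (α : ℝ) : Prop :=
  ∀ X : Finset V, (X.card : ℝ) ≤ (Fintype.card V : ℝ) / 2 →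
    α * (X.card : ℝ) ≤ ((G.extNeighborhood (X : Set V)).ncard : ℝ)

/-- The vertices of the graph obtained from `H` by placing `l` new vertices on every edge:
the old vertices, and for every edge `e` the new vertices `(e, 0), …, (e, l - 1)`. -/
abbrev SimpleGraph.SubdivVertex {V : Type*} (H : SimpleGraph V) (l : ℕ) : Type _ :=
  V ⊕ (H.edgeSet × Fin l)

/-- The vertex number `i` (`0 ≤ i ≤ l + 1`) of the path of length `l + 1` that replaces the edge
`e`. The path runs from the smaller endpoint of `e` through `(e, 0), …, (e, l - 1)` to the larger
endpoint of `e`. -/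
def SimpleGraph.subdivPath {V : Type*} [LinearOrder V] (H : SimpleGraph V) (l : ℕ)
    (e : H.edgeSet) : ℕ → H.SubdivVertex l
  | 0 => Sum.inl (e : Sym2 V).inf
  | i + 1 => if h : i < l then Sum.inr (e, ⟨i, h⟩) else Sum.inl (e : Sym2 V).sup

/-- The graph obtained from `H` by subdividing every edge exactly `l` times, that is, by replacing
every edge by a path of length `l + 1`, where these paths are internally disjoint. The linear order
on the vertices only serves to choose a direction in which the new vertices on an edge
are numbered. -/
def SimpleGraph.subdivide {V : Type*} [LinearOrder V] (H : SimpleGraph V) (l : ℕ) :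
    SimpleGraph (H.SubdivVertex l) :=
  SimpleGraph.fromRel fun x y =>
    ∃ (e : H.edgeSet) (i : ℕ), i ≤ l ∧ x = H.subdivPath l e i ∧ y = H.subdivPath l e (i + 1)

/-!
The graphs are subdivisions of bounded degree expanders, and three facts make this work.

*Expanders exist on every number `m` of vertices* (`SimpleGraph.exists_isExpanding`). Join every
vertex to its images under `21` permutations. If the resulting graph is not `1 / 2`-expanding, then
all these permutations map some nonempty set `X` with `#X = s ≤ m / 2` into a common set `Y` of
size `t = s + s / 2`. A random permutation does so with probability at most `(t / m) ^ s`, and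
`t / m ≤ 3 / 4`; the `21`-st power of this outweighs the number of pairs `(X, Y)` by a factor
`2 ^ s`, and the sum of `2 ^ (-s)` over `1 ≤ s ≤ m / 2` is less than `1`
(`Equiv.Perm.exists_expanding_tuple`).

*Subdividing every edge `l` times costs a factor of order `l`*
(`SimpleGraph.IsExpanding.subdivide`). Call a path of the subdivision mixed if it meets both `X` and
its complement. Every mixed path contains a vertex of the external neighborhood of `X`, and each
vertex lies on boundedly many paths. So it suffices to bound `#X` by a constant times `l` times the
number of mixed paths. Mixed paths are the same for `X` and its complement, and `X` is the smaller
of the two, so it may be assumed that the set contains at most half of the old vertices. Expansion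
of `H` then bounds the number of its old vertices by the number of mixed paths, and every new vertex
of the set lies on a mixed path or on one of the boundedly many paths at an old vertex of the set.

*Cycle lengths are divisible by `l + 1`* (`SimpleGraph.Walk.IsCycle.dvd_length_of_subdivide`). A new
vertex has only two neighbors, so a cycle that enters a path runs through all of it. With
`l + 1 = p` a divisor of `k`, the residues modulo `k` of cycle lengths are multiples of `p`.
-/

/-! ### Counting permutations -/

open Finset in
/-- A uniformly random permutation maps `X` into `Y` with probability
`(#Y).choose #X / n.choose #X`, because all images of `X` are equally likely. -/
theorem Equiv.Perm.card_filter_map_subset_mul_choose {ι : Type*} [Fintype ι] [DecidableEq ι]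
    (X Y : Finset ι) :
    #{π : Equiv.Perm ι | X.map π.toEmbedding ⊆ Y} * (Fintype.card ι).choose #X =
      (#Y).choose #X * (Fintype.card ι).factorial := by
  -- Composition with a permutation that maps `X` onto `W` shows that all fibers have the same size.
  have fiber (W : Finset ι) (hW : #W = #X) :
      #{π : Equiv.Perm ι | X.map π.toEmbedding = W} =
        #{π : Equiv.Perm ι | X.map π.toEmbedding = X} := by
    obtain ⟨σ, hσ⟩ : ∃ σ : Equiv.Perm ι, X.map σ.toEmbedding = W := by
      have e : {x // x ∈ X} ≃ {x // x ∈ W} := Finset.equivOfCardEq hW.symm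
      refine ⟨e.extendSubtype, Finset.eq_of_subset_of_card_le ?_ (by simp [hW])⟩
      intro y hy
      obtain ⟨x, hx, rfl⟩ := Finset.mem_map.1 hy
      exact e.extendSubtype_mem x hx
    refine Finset.card_bij' (fun π _ => σ⁻¹ * π) (fun π _ => σ * π) ?_ ?_ ?_ ?_
    · intro π hπ
      simp only [mem_filter, mem_univ, true_and] at hπ ⊢
      apply Finset.map_injective σ.toEmbedding
      rw [hσ, ← hπ, Finset.map_map]
      congr 1
      ext x
      simp
    · intro π hπ
      simp only [mem_filter, mem_univ, true_and] at hπ ⊢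
      rw [← hσ]
      conv_rhs => rw [← hπ, Finset.map_map]
      congr 1
    · intro π _; simp
    · intro π _; simp
  have total (Z : Finset ι) : #{π : Equiv.Perm ι | X.map π.toEmbedding ⊆ Z} =
      (#Z).choose #X * #{π : Equiv.Perm ι | X.map π.toEmbedding = X} := by
    rw [Finset.card_eq_sum_card_fiberwise (t := powersetCard #X Z)
      (f := fun π : Equiv.Perm ι => X.map π.toEmbedding)]
    · rw [← Finset.card_powersetCard, ← smul_eq_mul, ← Finset.sum_const]
      refine Finset.sum_congr rfl fun W hW => ?_
      rw [mem_powersetCard] at hW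
      rw [← fiber W hW.2, Finset.filter_filter]
      congr 1
      ext π
      simp only [mem_filter, mem_univ, true_and, and_iff_right_iff_imp]
      rintro rfl
      exact hW.1
    · intro π hπ
      simpa [mem_powersetCard] using hπ
  have all := total univ
  simp only [subset_univ, filter_true, card_univ, Fintype.card_perm] at all
  rw [total Y, all]
  ring

theorem Nat.descFactorial_mul_pow_le {t m : ℕ} (h : t ≤ m) (s : ℕ) :
    t.descFactorial s * m ^ s ≤ m.descFactorial s * t ^ s := by
  induction s with
  | zero => simp
  | succ s ih =>
    have key : (t - s) * m ≤ (m - s) * t := by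
      rw [Nat.sub_mul, Nat.sub_mul, Nat.mul_comm m t]
      exact Nat.sub_le_sub_left (Nat.mul_le_mul_left s h) _
    calc t.descFactorial (s + 1) * m ^ (s + 1)
        = (t.descFactorial s * m ^ s) * ((t - s) * m) := by
          rw [Nat.descFactorial_succ]; ring
      _ ≤ (m.descFactorial s * t ^ s) * ((m - s) * t) := Nat.mul_le_mul ih key
      _ = m.descFactorial (s + 1) * t ^ (s + 1) := by
          rw [Nat.descFactorial_succ]; ring

theorem Nat.choose_mul_pow_le {t m : ℕ} (h : t ≤ m) (s : ℕ) :
    t.choose s * m ^ s ≤ m.choose s * t ^ s := by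
  have := Nat.descFactorial_mul_pow_le h s
  rw [Nat.descFactorial_eq_factorial_mul_choose, Nat.descFactorial_eq_factorial_mul_choose,
    mul_assoc, mul_assoc] at this
  exact Nat.le_of_mul_le_mul_left this s.factorial_pos

theorem Nat.choose_le_three_mul_div_pow {n k : ℕ} (hk : 0 < k) :
    (n.choose k : ℝ) ≤ (3 * n / k) ^ k := by
  have h1 : (n.choose k : ℝ) ≤ (n : ℝ) ^ k / k.factorial := Nat.choose_le_pow_div k n
  have h2 : (k : ℝ) ^ k / k.factorial ≤ 3 ^ k := by
    refine (Real.pow_div_factorial_le_exp k (by positivity) k).trans ?_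
    rw [← Real.exp_one_pow]
    exact pow_le_pow_left₀ (Real.exp_pos 1).le Real.exp_one_lt_three.le k
  have hk' : (0 : ℝ) < (k : ℝ) ^ k := by positivity
  calc (n.choose k : ℝ) ≤ (n : ℝ) ^ k / k.factorial := h1
    _ = (n : ℝ) ^ k / (k : ℝ) ^ k * ((k : ℝ) ^ k / k.factorial) := by field_simp
    _ ≤ (n : ℝ) ^ k / (k : ℝ) ^ k * 3 ^ k := by gcongr
    _ = (3 * n / k) ^ k := by rw [div_pow, mul_pow]; ring

/-- The contribution of the sets of size `s` to the union bound. The two binomial coefficients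
count the pairs of a set of size `s` and a set of size `s + s / 2`; they cost a factor
`(81 / 2 * (m / t) ^ 3) ^ s`, where `t = s + s / 2 ≤ 3 * m / 4`, and `21` permutations pay for it. -/
theorem Nat.choose_mul_choose_mul_pow_le {m s : ℕ} (hs : 0 < s) (hsm : 2 * s ≤ m) :
    (m.choose s : ℝ) * m.choose (s + s / 2) * (((s + s / 2 : ℕ) / m : ℝ) ^ s) ^ 21 ≤
      (1 / 2) ^ s := by
  obtain ⟨t, ht⟩ : ∃ t, t = s + s / 2 := ⟨_, rfl⟩
  rw [← ht]
  have ht0 : 0 < t := by omega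
  have hm0 : 0 < m := by omega
  have hs' : (0 : ℝ) < s := by exact_mod_cast hs
  have ht' : (0 : ℝ) < t := by exact_mod_cast ht0
  have hm' : (0 : ℝ) < m := by exact_mod_cast hm0
  have hts : 2 * (t : ℝ) ≤ 3 * s := by exact_mod_cast (by omega : 2 * t ≤ 3 * s)
  have htm : 4 * (t : ℝ) ≤ 3 * m := by exact_mod_cast (by omega : 4 * t ≤ 3 * m)
  obtain ⟨q, hq⟩ : ∃ q : ℝ, q = t / m := ⟨_, rfl⟩
  have hq0 : 0 < q := by rw [hq]; positivity
  have hq1 : q ≤ 3 / 4 := by rw [hq, div_le_iff₀ hm']; linarith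
  have b1 : (m.choose s : ℝ) ≤ (9 / 2 / q) ^ s := by
    refine (Nat.choose_le_three_mul_div_pow hs).trans ?_
    refine pow_le_pow_left₀ (by positivity) ?_ s
    rw [hq, div_div_eq_mul_div, div_le_div_iff₀ hs' ht']
    nlinarith
  have b2 : (m.choose t : ℝ) ≤ (3 / q) ^ (2 * s) := by
    refine (Nat.choose_le_three_mul_div_pow ht0).trans ?_
    rw [hq, div_div_eq_mul_div]
    refine pow_le_pow_right₀ ?_ (by omega)
    rw [le_div_iff₀ ht']
    linarith
  rw [← hq]
  calc (m.choose s : ℝ) * m.choose t * (q ^ s) ^ 21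
      ≤ (9 / 2 / q) ^ s * (3 / q) ^ (2 * s) * (q ^ s) ^ 21 := by gcongr
    _ = (81 / 2 * q ^ 18) ^ s := by
      rw [pow_mul, pow_right_comm q s 21, ← mul_pow, ← mul_pow]
      congr 1
      field_simp
      norm_num
    _ ≤ (1 / 2) ^ s := by
      refine pow_le_pow_left₀ (by positivity) ?_ s
      have : q ^ 18 ≤ (3 / 4) ^ 18 := pow_le_pow_left₀ hq0.le hq1 18
      norm_num at this ⊢
      linarith

open Finset in
theorem sum_Icc_one_half_pow (M : ℕ) :
    ∑ s ∈ Icc 1 M, (1 / 2 : ℝ) ^ s = 1 - (1 / 2) ^ M := by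
  induction M with
  | zero => simp
  | succ M ih => rw [Finset.sum_Icc_succ_top (by omega), ih]; ring

open Finset in
theorem Equiv.Perm.card_filter_map_subset_le {m : ℕ} (X Y : Finset (Fin m)) (hm : 0 < m) :
    (#{π : Equiv.Perm (Fin m) | X.map π.toEmbedding ⊆ Y} : ℝ) ≤
      ((#Y : ℝ) / m) ^ #X * m.factorial := by
  have h1 := Equiv.Perm.card_filter_map_subset_mul_choose X Y
  rw [Fintype.card_fin] at h1
  have hXm : #X ≤ m := by simpa using X.card_le_univ
  have hYm : #Y ≤ m := by simpa using Y.card_le_univ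
  have hc : (0 : ℝ) < m.choose #X := by exact_mod_cast Nat.choose_pos hXm
  have h2 : ((#Y).choose #X : ℝ) * m ^ #X ≤ m.choose #X * #Y ^ #X := by
    exact_mod_cast Nat.choose_mul_pow_le hYm #X
  have hm' : (0 : ℝ) < (m : ℝ) ^ #X := by positivity
  have h3 : (#{π : Equiv.Perm (Fin m) | X.map π.toEmbedding ⊆ Y} : ℝ) * m.choose #X =
      (#Y).choose #X * m.factorial := by exact_mod_cast h1
  refine le_of_mul_le_mul_right ?_ hc
  rw [h3, div_pow]
  calc ((#Y).choose #X : ℝ) * m.factorial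
      = (#Y).choose #X * m ^ #X / m ^ #X * m.factorial := by field_simp
    _ ≤ m.choose #X * #Y ^ #X / m ^ #X * m.factorial := by gcongr
    _ = _ := by ring

open Finset in
/-- The union bound over all pairs `(X, Y)`: some `21` permutations do not all map a nonempty set
`X` of at most half of the points into a common set of size at most `3 / 2 * #X`. -/
theorem Equiv.Perm.exists_expanding_tuple (m : ℕ) :
    ∃ π : Fin 21 → Equiv.Perm (Fin m), ∀ X Y : Finset (Fin m), X.Nonempty → 2 * #X ≤ m →
      2 * #Y ≤ 3 * #X → ∃ i, ¬ X.map (π i).toEmbedding ⊆ Y := by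
  classical
  obtain rfl | hm := Nat.eq_zero_or_pos m
  · exact ⟨fun _ => 1, fun X Y hX => (hX.ne_empty (Subsingleton.elim _ _)).elim⟩
  by_contra! hbad
  let bad (X Y : Finset (Fin m)) : Finset (Fin 21 → Equiv.Perm (Fin m)) :=
    Fintype.piFinset fun _ => {π : Equiv.Perm (Fin m) | X.map π.toEmbedding ⊆ Y}
  have hcover : (univ : Finset (Fin 21 → Equiv.Perm (Fin m))) ⊆
      (Icc 1 (m / 2)).biUnion fun s => (powersetCard s univ).biUnion fun X =>
        (powersetCard (s + s / 2) univ).biUnion fun Y => bad X Y := by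
    intro π _
    obtain ⟨X, Y, hX, hXm, hY, hπ⟩ := hbad π
    have hX' := hX.card_pos
    obtain ⟨Z, hYZ, hZ⟩ := Finset.exists_superset_card_eq (s := Y) (n := #X + #X / 2) (by omega)
      (by simp only [Fintype.card_fin]; omega)
    simp only [mem_biUnion, mem_Icc, mem_powersetCard, subset_univ, true_and]
    refine ⟨#X, by omega, X, rfl, Z, hZ, ?_⟩
    simpa [bad] using fun i => (hπ i).trans hYZ
  have hfac : (0 : ℝ) < (m.factorial : ℝ) ^ 21 := by positivity
  have hle : (m.factorial : ℝ) ^ 21 ≤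
      ∑ s ∈ Icc 1 (m / 2), (1 / 2 : ℝ) ^ s * (m.factorial : ℝ) ^ 21 := by
    calc (m.factorial : ℝ) ^ 21
        = (#(univ : Finset (Fin 21 → Equiv.Perm (Fin m))) : ℝ) := by
          simp [Fintype.card_perm]
      _ ≤ ∑ s ∈ Icc 1 (m / 2), ∑ X ∈ powersetCard s (univ : Finset (Fin m)),
            ∑ Y ∈ powersetCard (s + s / 2) (univ : Finset (Fin m)), (#(bad X Y) : ℝ) := by
          have := (card_le_card hcover).trans (card_biUnion_le.trans (sum_le_sum fun s _ =>
            card_biUnion_le.trans (sum_le_sum fun X _ => card_biUnion_le)))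
          exact_mod_cast this
      _ ≤ ∑ s ∈ Icc 1 (m / 2), ∑ X ∈ powersetCard s (univ : Finset (Fin m)),
            ∑ Y ∈ powersetCard (s + s / 2) (univ : Finset (Fin m)),
              ((((s + s / 2 : ℕ) : ℝ) / m) ^ s * m.factorial) ^ 21 := by
          refine sum_le_sum fun s _ => sum_le_sum fun X hX => sum_le_sum fun Y hY => ?_
          have h := Equiv.Perm.card_filter_map_subset_le X Y hm
          rw [(mem_powersetCard.1 hX).2, (mem_powersetCard.1 hY).2] at h
          simp only [bad, Fintype.card_piFinset, prod_const, card_univ, Fintype.card_fin,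
            Nat.cast_pow]
          exact pow_le_pow_left₀ (by positivity) h 21
      _ ≤ _ := by
          refine sum_le_sum fun s hs => ?_
          rw [mem_Icc] at hs
          simp only [sum_const, card_powersetCard, card_univ, Fintype.card_fin, nsmul_eq_mul]
          rw [mul_pow, ← mul_assoc, ← mul_assoc]
          have := Nat.choose_mul_choose_mul_pow_le (m := m) (s := s) (by omega) (by omega)
          gcongr
  rw [← sum_mul, sum_Icc_one_half_pow, sub_mul, one_mul] at hle
  have : 0 < (1 / 2 : ℝ) ^ (m / 2) * (m.factorial : ℝ) ^ 21 := by positivity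
  linarith

/-! ### Expanders of bounded degree -/

/-- The graph in which every vertex `x` is joined to the vertices `π i x`, except to
itself. -/
def SimpleGraph.ofPerms {V ι : Type*} (π : ι → Equiv.Perm V) : SimpleGraph V :=
  SimpleGraph.fromRel fun x y => ∃ i, π i x = y

theorem SimpleGraph.ncard_neighborSet_ofPerms_le {V : Type*} {d : ℕ}
    (π : Fin d → Equiv.Perm V) (v : V) :
    ((SimpleGraph.ofPerms π).neighborSet v).ncard ≤ d + d := by
  have hsub : (SimpleGraph.ofPerms π).neighborSet v ⊆
      Set.range (Sum.elim (fun i => π i v) fun i => (π i).symm v) := by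
    intro w hw
    have hadj : (SimpleGraph.fromRel fun x y => ∃ i, π i x = y).Adj v w := hw
    obtain ⟨-, ⟨i, hi⟩ | ⟨i, hi⟩⟩ := (SimpleGraph.fromRel_adj _ _ _).1 hadj
    · exact ⟨Sum.inl i, hi⟩
    · exact ⟨Sum.inr i, by simp [← hi]⟩
  refine (Set.ncard_le_ncard hsub (Set.finite_range _)).trans ?_
  rw [← Set.image_univ]
  refine (Set.ncard_image_le Set.finite_univ).trans ?_
  simp [Set.ncard_univ]

open Finset in
/-- If the permutations `π i` do not all map `X` into a set of size at most `3 / 2 * #X`, then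
`X` together with its external neighborhood is larger than this. -/
theorem SimpleGraph.exists_isExpanding (m : ℕ) :
    ∃ H : SimpleGraph (Fin m), H.IsExpanding (1 / 2) ∧
      ∀ v, (H.neighborSet v).ncard ≤ 42 := by
  classical
  obtain ⟨π, hπ⟩ := Equiv.Perm.exists_expanding_tuple m
  refine ⟨SimpleGraph.ofPerms π, fun X hX => ?_, SimpleGraph.ncard_neighborSet_ofPerms_le π⟩
  by_contra! hlt
  obtain rfl | hne := X.eq_empty_or_nonempty
  · have : (0 : ℝ) ≤ (((SimpleGraph.ofPerms π).extNeighborhood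
      ((∅ : Finset (Fin m)) : Set (Fin m))).ncard : ℝ) := by positivity
    simp only [card_empty, Nat.cast_zero, mul_zero] at hlt
    linarith
  set N := (SimpleGraph.ofPerms π).extNeighborhood (X : Set (Fin m))
  have hNf : N.Finite := Set.toFinite _
  have hNcard : 2 * #hNf.toFinset ≤ #X := by
    rw [← Set.ncard_eq_toFinset_card N hNf]
    have : 2 * (N.ncard : ℝ) < #X := by linarith
    exact_mod_cast this.le
  rw [Fintype.card_fin] at hX
  have hXm : 2 * #X ≤ m := by
    have : 2 * (#X : ℝ) ≤ m := by linarith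
    exact_mod_cast this
  obtain ⟨i, hi⟩ := hπ X (X ∪ hNf.toFinset) hne hXm (by
    have := card_union_le X hNf.toFinset
    omega)
  apply hi
  intro y hy
  obtain ⟨x, hx, rfl⟩ := mem_map.1 hy
  simp only [mem_union, Set.Finite.mem_toFinset]
  by_cases hmem : π i x ∈ X
  · exact Or.inl hmem
  · refine Or.inr ⟨hmem, x, hx, (SimpleGraph.fromRel_adj _ _ _).2 ⟨?_, Or.inl ⟨i, rfl⟩⟩⟩
    intro h
    exact hmem (h ▸ hx)

namespace SimpleGraph

/-! ### The paths of the subdivision -/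

section Path

variable {V : Type*} [LinearOrder V] (H : SimpleGraph V) (l : ℕ)

theorem subdivPath_zero (e : H.edgeSet) : H.subdivPath l e 0 = Sum.inl (e : Sym2 V).inf := rfl

theorem subdivPath_succ (e : H.edgeSet) (i : Fin l) :
    H.subdivPath l e (i + 1) = Sum.inr (e, i) := by
  simp [subdivPath]

theorem subdivPath_last (e : H.edgeSet) :
    H.subdivPath l e (l + 1) = Sum.inl (e : Sym2 V).sup := by
  simp [subdivPath]

variable {H l}

theorem subdivPath_eq_inr {e : H.edgeSet} {i : ℕ} {x : H.edgeSet × Fin l}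
    (h : H.subdivPath l e i = Sum.inr x) : e = x.1 ∧ i = x.2 + 1 := by
  cases i with
  | zero => simp [subdivPath] at h
  | succ i =>
    rw [subdivPath] at h
    split_ifs at h with hi
    rw [Sum.inr.injEq] at h
    simp [← h]

theorem inf_mem_edge (e : Sym2 V) : e.inf ∈ e := by
  induction e with | _ a b
  rcases le_total a b with h | h <;> simp [h]

theorem sup_mem_edge (e : Sym2 V) : e.sup ∈ e := by
  induction e with | _ a b
  rcases le_total a b with h | h <;> simp [h]

theorem inf_ne_sup (e : H.edgeSet) : (e : Sym2 V).inf ≠ (e : Sym2 V).sup := by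
  obtain ⟨e, he⟩ := e
  induction e with | _ a b
  have hne : a ≠ b := H.ne_of_adj he
  simpa using hne

theorem mem_of_subdivPath_eq_inl {e : H.edgeSet} {i : ℕ} {v : V}
    (h : H.subdivPath l e i = Sum.inl v) : v ∈ (e : Sym2 V) := by
  cases i with
  | zero =>
    rw [subdivPath_zero, Sum.inl.injEq] at h
    exact h ▸ inf_mem_edge _
  | succ i =>
    rw [subdivPath] at h
    split_ifs at h with hi
    rw [Sum.inl.injEq] at h
    exact h ▸ sup_mem_edge _

/-- A new vertex lies on one path only, at one position only. -/
theorem subdivPath_eq_subdivPath {e e' : H.edgeSet} {i j : ℕ} (hi : 1 ≤ i) (hil : i ≤ l)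
    (h : H.subdivPath l e i = H.subdivPath l e' j) : e = e' ∧ i = j := by
  obtain ⟨i, rfl⟩ : ∃ i', i = i' + 1 := ⟨i - 1, by omega⟩
  have h1 := subdivPath_succ H l e ⟨i, hil⟩
  rw [h] at h1
  obtain ⟨h2, h3⟩ := subdivPath_eq_inr h1
  exact ⟨h2.symm, h3.symm⟩

theorem subdivPath_ne_succ (e : H.edgeSet) {i : ℕ} (hi : i ≤ l) :
    H.subdivPath l e i ≠ H.subdivPath l e (i + 1) := by
  intro h
  rcases Nat.eq_zero_or_pos i with rfl | hi0
  · rcases Nat.eq_zero_or_pos l with rfl | hl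
    · rw [subdivPath_zero, subdivPath_last, Sum.inl.injEq] at h
      exact inf_ne_sup e h
    · have := (subdivPath_eq_subdivPath le_rfl hl h.symm).2
      omega
  · have := (subdivPath_eq_subdivPath hi0 hi h).2
    omega

theorem subdivide_adj_subdivPath (e : H.edgeSet) {i : ℕ} (hi : i ≤ l) :
    (H.subdivide l).Adj (H.subdivPath l e i) (H.subdivPath l e (i + 1)) :=
  (fromRel_adj _ _ _).2 ⟨subdivPath_ne_succ e hi, Or.inl ⟨e, i, hi, rfl, rfl⟩⟩

/-- The `i`-th edge of the path that replaces `e`. -/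
def subdivEdge (H : SimpleGraph V) (l : ℕ) (e : H.edgeSet) (i : ℕ) : Sym2 (H.SubdivVertex l) :=
  s(H.subdivPath l e i, H.subdivPath l e (i + 1))

theorem exists_subdivEdge_eq {x : Sym2 (H.SubdivVertex l)} (hx : x ∈ (H.subdivide l).edgeSet) :
    ∃ (e : H.edgeSet) (i : ℕ), i ≤ l ∧ H.subdivEdge l e i = x := by
  induction x with | _ a b
  have hadj : (SimpleGraph.fromRel fun x y => ∃ (e : H.edgeSet) (i : ℕ), i ≤ l ∧
    x = H.subdivPath l e i ∧ y = H.subdivPath l e (i + 1)).Adj a b := hx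
  obtain ⟨-, ⟨e, i, hi, rfl, rfl⟩ | ⟨e, i, hi, rfl, rfl⟩⟩ := (fromRel_adj _ _ _).1 hadj
  · exact ⟨e, i, hi, rfl⟩
  · exact ⟨e, i, hi, Sym2.eq_swap⟩

/-- If `0 < l`, every edge of the subdivision has an end that is a new vertex, and this end
determines the path. -/
theorem subdivEdge_injective (hl : 0 < l) {e e' : H.edgeSet} {i j : ℕ} (hi : i ≤ l) (hj : j ≤ l)
    (h : H.subdivEdge l e i = H.subdivEdge l e' j) : e = e' ∧ i = j := by
  have main (e e' : H.edgeSet) (i j : ℕ) (hi : i ≤ l) (hj : j ≤ l)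
      (h1 : H.subdivPath l e i = H.subdivPath l e' j)
      (h2 : H.subdivPath l e (i + 1) = H.subdivPath l e' (j + 1)) : e = e' ∧ i = j := by
    rcases Nat.eq_zero_or_pos i with rfl | hi0
    · obtain ⟨he, hij⟩ := subdivPath_eq_subdivPath le_rfl hl h2
      exact ⟨he, by omega⟩
    · exact subdivPath_eq_subdivPath hi0 hi h1
  have swapped (e e' : H.edgeSet) (i j : ℕ) (hi : i ≤ l) (hj : j ≤ l)
      (h1 : H.subdivPath l e i = H.subdivPath l e' (j + 1))
      (h2 : H.subdivPath l e (i + 1) = H.subdivPath l e' j) : False := by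
    rcases Nat.eq_zero_or_pos i with rfl | hi0
    · obtain ⟨he, hij⟩ := subdivPath_eq_subdivPath le_rfl hl h2
      subst he hij
      rcases Nat.lt_or_ge 1 l with hl1 | hl1
      · have := (subdivPath_eq_subdivPath (by omega) (by omega) h1.symm).2
        omega
      · obtain rfl : l = 1 := by omega
        rw [subdivPath_zero, subdivPath_last, Sum.inl.injEq] at h1
        exact inf_ne_sup e h1
    · obtain ⟨he, hij⟩ := subdivPath_eq_subdivPath hi0 hi h1
      subst he hij
      rcases Nat.eq_zero_or_pos j with rfl | hj0
      · rcases Nat.lt_or_ge 1 l with hl1 | hl1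
        · have := (subdivPath_eq_subdivPath (by omega) (by omega) h2).2
          omega
        · obtain rfl : l = 1 := by omega
          rw [subdivPath_zero, subdivPath_last, Sum.inl.injEq] at h2
          exact inf_ne_sup e h2.symm
      · have := (subdivPath_eq_subdivPath hj0 hj h2.symm).2
        omega
  rcases Sym2.eq_iff.1 h with ⟨h1, h2⟩ | ⟨h1, h2⟩
  · exact main e e' i j hi hj h1 h2
  · exact (swapped e e' i j hi hj h1 h2).elim

theorem neighborSet_subdivide_subset (e : H.edgeSet) {i : ℕ} (hi : i < l) :
    (H.subdivide l).neighborSet (H.subdivPath l e (i + 1)) ⊆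
      {H.subdivPath l e i, H.subdivPath l e (i + 2)} := by
  intro y hy
  have hadj : (SimpleGraph.fromRel fun x y => ∃ (e : H.edgeSet) (i : ℕ), i ≤ l ∧
    x = H.subdivPath l e i ∧ y = H.subdivPath l e (i + 1)).Adj _ y := hy
  obtain ⟨-, ⟨e', j, hj, h, rfl⟩ | ⟨e', j, hj, rfl, h⟩⟩ := (fromRel_adj _ _ _).1 hadj
  · obtain ⟨rfl, rfl⟩ := subdivPath_eq_subdivPath (by omega) (by omega) h
    exact Or.inr rfl
  · obtain ⟨rfl, hij⟩ := subdivPath_eq_subdivPath (by omega) (by omega) h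
    obtain rfl : i = j := by omega
    exact Or.inl rfl

end Path

/-! ### Cycles of the subdivision -/

section Cycle

variable {V : Type*} [LinearOrder V] {H : SimpleGraph V} {l : ℕ}

/-- A cycle uses both edges at every new vertex it visits. -/
theorem Walk.IsCycle.subdivEdge_mem_of_mem_support {v : H.SubdivVertex l}
    {C : (H.subdivide l).Walk v v} (hC : C.IsCycle) (e : H.edgeSet) {i : ℕ} (hi : i < l)
    (hmem : H.subdivPath l e (i + 1) ∈ C.support) :
    H.subdivEdge l e i ∈ C.edges ∧ H.subdivEdge l e (i + 1) ∈ C.edges := by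
  have hsub : C.toSubgraph.neighborSet (H.subdivPath l e (i + 1)) ⊆
      {H.subdivPath l e i, H.subdivPath l e (i + 2)} :=
    (C.toSubgraph.neighborSet_subset _).trans (neighborSet_subdivide_subset e hi)
  have heq := Set.eq_of_subset_of_ncard_le hsub (by
    rw [hC.ncard_neighborSet_toSubgraph_eq_two hmem]
    exact Set.ncard_insert_le _ _ |>.trans (by simp)) (Set.toFinite _)
  constructor
  · have h : H.subdivPath l e i ∈ C.toSubgraph.neighborSet (H.subdivPath l e (i + 1)) := by
      rw [heq]; exact Or.inl rfl
    exact Walk.adj_toSubgraph_iff_mem_edges.1 h.symm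
  · have h : H.subdivPath l e (i + 2) ∈ C.toSubgraph.neighborSet (H.subdivPath l e (i + 1)) := by
      rw [heq]; exact Or.inr rfl
    exact Walk.adj_toSubgraph_iff_mem_edges.1 h

theorem Walk.IsCycle.subdivEdge_mem_iff {v : H.SubdivVertex l}
    {C : (H.subdivide l).Walk v v} (hC : C.IsCycle) (e : H.edgeSet) {i : ℕ} (hi : i ≤ l) :
    H.subdivEdge l e i ∈ C.edges ↔ H.subdivEdge l e 0 ∈ C.edges := by
  induction i with
  | zero => rfl
  | succ i ih =>
    rw [← ih (by omega)]
    exact ⟨fun h => (hC.subdivEdge_mem_of_mem_support e hi (C.fst_mem_support_of_mem_edges h)).1,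
      fun h => (hC.subdivEdge_mem_of_mem_support e hi (C.snd_mem_support_of_mem_edges h)).2⟩

/-- A cycle consists of whole paths, each with `l + 1` edges. -/
theorem Walk.IsCycle.dvd_length_of_subdivide (hl : 0 < l) {v : H.SubdivVertex l}
    {C : (H.subdivide l).Walk v v} (hC : C.IsCycle) : l + 1 ∣ C.length := by
  classical
  have hfin : {e : H.edgeSet | H.subdivEdge l e 0 ∈ C.edges}.Finite :=
    Set.Finite.preimage (f := fun e => H.subdivEdge l e 0)
      (fun e _ e' _ h => (subdivEdge_injective hl (Nat.zero_le l) (Nat.zero_le l) h).1)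
      (List.finite_toSet C.edges)
  have hcard : C.edges.toFinset = (hfin.toFinset ×ˢ Finset.range (l + 1)).image
      fun x => H.subdivEdge l x.1 x.2 := by
    ext x
    simp only [List.mem_toFinset, Finset.mem_image, Finset.mem_product, Set.Finite.mem_toFinset,
      Set.mem_ofPred_eq, Finset.mem_range, Prod.exists]
    constructor
    · intro hx
      obtain ⟨e, i, hi, rfl⟩ := exists_subdivEdge_eq (C.edges_subset_edgeSet hx)
      exact ⟨e, i, ⟨(hC.subdivEdge_mem_iff e hi).1 hx, by omega⟩, rfl⟩
    · rintro ⟨e, i, ⟨he, hi⟩, rfl⟩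
      exact (hC.subdivEdge_mem_iff e (by omega)).2 he
  have hinj : Set.InjOn (fun x : H.edgeSet × ℕ => H.subdivEdge l x.1 x.2)
      (hfin.toFinset ×ˢ Finset.range (l + 1) : Finset (H.edgeSet × ℕ)) := by
    rintro ⟨e, i⟩ hx ⟨e', j⟩ hy h
    simp only [Finset.coe_product, Set.mem_prod, Finset.mem_coe, Finset.mem_range] at hx hy
    obtain ⟨h1, h2⟩ := subdivEdge_injective hl (by omega) (by omega) h
    exact Prod.ext h1 h2
  rw [← C.length_edges, ← List.toFinset_card_of_nodup hC.isTrail.edges_nodup, hcard,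
    Finset.card_image_of_injOn hinj, Finset.card_product, Finset.card_range]
  exact dvd_mul_left _ _

end Cycle

end SimpleGraph

/-! ### Expansion of the subdivision -/

theorem Nat.exists_lt_not_iff_succ {P : ℕ → Prop} {n i j : ℕ} (hi : i ≤ n) (hj : j ≤ n)
    (hPi : P i) (hPj : ¬ P j) : ∃ k < n, ¬ (P k ↔ P (k + 1)) := by
  by_contra! h
  have hconst (k : ℕ) (hk : k ≤ n) : P k ↔ P 0 := by
    induction k with
    | zero => rfl
    | succ k ih => rw [← h k (by omega), ih (by omega)]
  exact hPj ((hconst j hj).2 ((hconst i hi).1 hPi))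

namespace SimpleGraph

open Finset

theorem IsExpanding.mono {V : Type*} [Fintype V] {H : SimpleGraph V} {α β : ℝ}
    (h : H.IsExpanding β) (hαβ : α ≤ β) : H.IsExpanding α := fun X hX =>
  (mul_le_mul_of_nonneg_right hαβ (Nat.cast_nonneg _)).trans (h X hX)

section Expansion

variable {V : Type*} [LinearOrder V] (H : SimpleGraph V) (l : ℕ)

open Classical in
/-- The edges of `H` whose path in the subdivision meets both `X` and the complement of `X`. -/
noncomputable def mixedEdges [Fintype H.edgeSet] (X : Finset (H.SubdivVertex l)) : Finset H.edgeSet :=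
  {e | (∃ i ≤ l + 1, H.subdivPath l e i ∈ X) ∧ ∃ j ≤ l + 1, H.subdivPath l e j ∉ X}

open Classical in
/-- The vertices of `H` that belong to a set of vertices of the subdivision. -/
noncomputable def oldVertices [Fintype V] (X : Finset (H.SubdivVertex l)) : Finset V :=
  {v | Sum.inl v ∈ X}

variable {H l}

theorem mem_mixedEdges [Fintype H.edgeSet] {X : Finset (H.SubdivVertex l)} {e : H.edgeSet} :
    e ∈ H.mixedEdges l X ↔
      (∃ i ≤ l + 1, H.subdivPath l e i ∈ X) ∧ ∃ j ≤ l + 1, H.subdivPath l e j ∉ X := by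
  simp [mixedEdges]

theorem mem_oldVertices [Fintype V] {X : Finset (H.SubdivVertex l)} {v : V} :
    v ∈ H.oldVertices l X ↔ Sum.inl v ∈ X := by
  simp [oldVertices]

open Classical in
theorem mixedEdges_compl [Fintype H.edgeSet] [Fintype (H.SubdivVertex l)]
    (X : Finset (H.SubdivVertex l)) :
    H.mixedEdges l Xᶜ = H.mixedEdges l X := by
  ext e
  simp only [mem_mixedEdges, mem_compl, not_not]
  exact and_comm

open Classical in
theorem oldVertices_compl [Fintype V] [Fintype (H.SubdivVertex l)]
    (X : Finset (H.SubdivVertex l)) :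
    H.oldVertices l Xᶜ = (H.oldVertices l X)ᶜ := by
  ext v
  simp [mem_oldVertices]

variable [Fintype V] [Fintype H.edgeSet]

open Classical in
theorem card_filter_mem_edge_le {Δ : ℕ} (hΔ : ∀ v, (H.neighborSet v).ncard ≤ Δ) (v : V) :
    #{e : H.edgeSet | v ∈ (e : Sym2 V)} ≤ Δ := by
  refine le_trans ?_ (hΔ v)
  rw [Set.ncard_eq_toFinset_card', ← card_map (Function.Embedding.subtype _)]
  refine (card_le_card ?_).trans (card_image_le (s := (H.neighborSet v).toFinset)
    (f := fun w => s(v, w)))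
  intro e he
  simp only [mem_map, mem_filter, mem_univ, true_and, Function.Embedding.subtype_apply,
    Subtype.exists, exists_and_left, exists_prop] at he
  obtain ⟨e, hv, he, rfl⟩ := he
  obtain ⟨w, rfl⟩ := Sym2.mem_iff_exists.1 hv
  exact mem_image.2 ⟨w, by simpa using he, rfl⟩

/-- A new vertex of `X` lies on a mixed path or on a path that starts in `X`. -/
theorem card_le_mul_card_mixedEdges_add {Δ : ℕ} (hΔ : ∀ v, (H.neighborSet v).ncard ≤ Δ)
    (X : Finset (H.SubdivVertex l)) :
    #X ≤ l * #(H.mixedEdges l X) + (l * Δ + 1) * #(H.oldVertices l X) := by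
  classical
  let F : Finset H.edgeSet :=
    (H.oldVertices l X).biUnion fun v => {e : H.edgeSet | v ∈ (e : Sym2 V)}
  have hF : #F ≤ #(H.oldVertices l X) * Δ :=
    card_biUnion_le_card_mul _ _ _ fun v _ => card_filter_mem_edge_le hΔ v
  have hsub : X ⊆ (H.oldVertices l X).image Sum.inl ∪
      ((H.mixedEdges l X ∪ F) ×ˢ (univ : Finset (Fin l))).image Sum.inr := by
    rintro (v | ⟨e, i⟩) hx
    · simpa [mem_oldVertices] using hx
    · simp only [mem_union, mem_image, mem_product, mem_univ, and_true]
      refine Or.inr ⟨(e, i), ?_, rfl⟩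
      by_cases h : H.subdivPath l e 0 ∈ X
      · exact Or.inr (mem_biUnion.2 ⟨_, mem_oldVertices.2 h, by simp [inf_mem_edge]⟩)
      · refine Or.inl (mem_mixedEdges.2 ⟨⟨i + 1, by omega, ?_⟩, 0, by omega, h⟩)
        rwa [subdivPath_succ]
  calc #X ≤ #(H.oldVertices l X) + (#(H.mixedEdges l X) + #F) * l := by
        refine (card_le_card hsub).trans ((card_union_le _ _).trans ?_)
        refine Nat.add_le_add card_image_le (card_image_le.trans ?_)
        rw [card_product, card_univ, Fintype.card_fin]
        exact Nat.mul_le_mul_right _ (card_union_le _ _)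
    _ ≤ #(H.oldVertices l X) + (#(H.mixedEdges l X) + #(H.oldVertices l X) * Δ) * l := by gcongr
    _ = _ := by ring

/-- Every vertex of `H` adjacent to an old vertex of `X`, but not in `X`, is the end of a mixed
path whose other end is in `X`. -/
theorem ncard_extNeighborhood_oldVertices_le (X : Finset (H.SubdivVertex l)) :
    (H.extNeighborhood (H.oldVertices l X : Set V)).ncard ≤ #(H.mixedEdges l X) := by
  classical
  let outer (e : H.edgeSet) : V :=
    if (e : Sym2 V).inf ∈ H.oldVertices l X then (e : Sym2 V).sup else (e : Sym2 V).inf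
  have hsub : H.extNeighborhood (H.oldVertices l X : Set V) ⊆
      ((H.mixedEdges l X).image outer : Finset V) := by
    rintro v ⟨hv, u, hu, hadj⟩
    rw [mem_coe] at hv hu
    simp only [coe_image, Set.mem_image, mem_coe, mem_mixedEdges]
    refine ⟨⟨s(u, v), hadj⟩, ?_, ?_⟩
    · rw [mem_oldVertices] at hu hv
      rcases le_total u v with h | h
      · refine ⟨⟨0, by omega, ?_⟩, l + 1, le_rfl, ?_⟩
        · simpa [subdivPath_zero, h] using hu
        · simpa [subdivPath_last, h] using hv
      · refine ⟨⟨l + 1, le_rfl, ?_⟩, 0, by omega, ?_⟩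
        · simpa [subdivPath_last, h] using hu
        · simpa [subdivPath_zero, h] using hv
    · rcases le_total u v with h | h <;> simp [outer, h, hu, hv]
  refine (Set.ncard_le_ncard hsub (Set.toFinite _)).trans ?_
  rw [Set.ncard_coe_finset]
  exact card_image_le

/-- Every mixed path contains a vertex of the external neighborhood of `X`, and a vertex lies on at
most `Δ` paths. -/
theorem card_mixedEdges_le {Δ : ℕ} (hΔ0 : 0 < Δ) (hΔ : ∀ v, (H.neighborSet v).ncard ≤ Δ)
    (X : Finset (H.SubdivVertex l)) :
    #(H.mixedEdges l X) ≤
      Δ * ((H.subdivide l).extNeighborhood (X : Set (H.SubdivVertex l))).ncard := by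
  classical
  have hex (e : H.edgeSet) (he : e ∈ H.mixedEdges l X) : ∃ i,
      H.subdivPath l e i ∈ (H.subdivide l).extNeighborhood (X : Set (H.SubdivVertex l)) := by
    obtain ⟨⟨i, hi, hiX⟩, j, hj, hjX⟩ := mem_mixedEdges.1 he
    obtain ⟨k, hk, hkX⟩ :=
      Nat.exists_lt_not_iff_succ (P := fun i => H.subdivPath l e i ∈ X) hi hj hiX hjX
    have hadj := subdivide_adj_subdivPath e (Nat.lt_succ_iff.1 hk)
    by_cases h : H.subdivPath l e k ∈ X
    · exact ⟨k + 1, fun h' => hkX (iff_of_true h h'), _, h, hadj⟩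
    · exact ⟨k, h, _, by_contra fun h' => hkX (iff_of_false h h'), hadj.symm⟩
  choose! f hf using hex
  rw [Set.ncard_eq_toFinset_card']
  refine card_le_mul_card_image_of_maps_to (f := fun e => H.subdivPath l e (f e))
    (fun e he => by simpa using hf e he) Δ fun x _ => ?_
  rcases x with v | x
  · refine (card_le_card ?_).trans (card_filter_mem_edge_le hΔ v)
    intro e he
    rw [mem_filter] at he ⊢
    exact ⟨mem_univ _, mem_of_subdivPath_eq_inl he.2⟩
  · refine le_trans (card_le_one.2 fun e he e' he' => ?_) hΔ0
    rw [mem_filter] at he he'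
    rw [(subdivPath_eq_inr he.2).1, (subdivPath_eq_inr he'.2).1]

/-- The bound that is applied to `X` or to its complement, whichever contains at most half of the
old vertices. -/
theorem IsExpanding.mul_card_le_card_mixedEdges {α₀ : ℝ} {Δ : ℕ} (hα₀ : 0 < α₀)
    (hH : H.IsExpanding α₀) (hΔ : ∀ v, (H.neighborSet v).ncard ≤ Δ) (hl : 0 < l)
    (X : Finset (H.SubdivVertex l))
    (hX : (#(H.oldVertices l X) : ℝ) ≤ (Fintype.card V : ℝ) / 2) :
    (#X : ℝ) ≤ l * (1 + (Δ + 1) / α₀) * #(H.mixedEdges l X) := by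
  have h1 : (#X : ℝ) ≤ l * #(H.mixedEdges l X) + (l * Δ + 1) * #(H.oldVertices l X) := by
    exact_mod_cast card_le_mul_card_mixedEdges_add hΔ X
  have h2 : α₀ * #(H.oldVertices l X) ≤ #(H.mixedEdges l X) :=
    (hH _ hX).trans (by exact_mod_cast ncard_extNeighborhood_oldVertices_le X)
  have h3 : (#(H.oldVertices l X) : ℝ) ≤ #(H.mixedEdges l X) / α₀ := by
    rw [le_div_iff₀ hα₀]; linarith
  have hl1 : (1 : ℝ) ≤ l := by exact_mod_cast hl
  calc (#X : ℝ) ≤ l * #(H.mixedEdges l X) + (l * Δ + 1) * #(H.oldVertices l X) := h1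
    _ ≤ l * #(H.mixedEdges l X) + (l * Δ + l) * (#(H.mixedEdges l X) / α₀) := by gcongr
    _ = l * (1 + (Δ + 1) / α₀) * #(H.mixedEdges l X) := by ring

/-- Subdividing every edge of a bounded degree expander `l` times costs a factor of order `l` in the
expansion: up to a constant factor, a set `X` of at most half of the vertices has at most `l` times
as many vertices as there are mixed paths, and each of these paths contributes to the external
neighborhood of `X`. -/
theorem IsExpanding.subdivide [Fintype (H.SubdivVertex l)] {α₀ : ℝ} {Δ : ℕ} (hα₀ : 0 < α₀)
    (hΔ0 : 0 < Δ) (hH : H.IsExpanding α₀) (hΔ : ∀ v, (H.neighborSet v).ncard ≤ Δ) (hl : 0 < l) :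
    (H.subdivide l).IsExpanding (1 / (Δ * (1 + (Δ + 1) / α₀)) / l) := by
  classical
  intro X hX
  have hmixed : (#X : ℝ) ≤ l * (1 + (Δ + 1) / α₀) * #(H.mixedEdges l X) := by
    rcases le_or_gt (#(H.oldVertices l X) : ℝ) ((Fintype.card V : ℝ) / 2) with h | h
    · exact hH.mul_card_le_card_mixedEdges hα₀ hΔ hl X h
    -- A set and its complement have the same mixed paths, and `X` is no larger than `Xᶜ`.
    · have hcompl : (#(Xᶜ) : ℝ) = Fintype.card (H.SubdivVertex l) - #X := by
        rw [card_compl, Nat.cast_sub (card_le_univ X)]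
      have hold : (#(H.oldVertices l Xᶜ) : ℝ) = Fintype.card V - #(H.oldVertices l X) := by
        rw [oldVertices_compl, card_compl, Nat.cast_sub (card_le_univ _)]
      have := hH.mul_card_le_card_mixedEdges hα₀ hΔ hl Xᶜ (by rw [hold]; linarith)
      rw [mixedEdges_compl] at this
      linarith
  have hN : (#(H.mixedEdges l X) : ℝ) ≤
      Δ * ((H.subdivide l).extNeighborhood (X : Set (H.SubdivVertex l))).ncard := by
    exact_mod_cast card_mixedEdges_le hΔ0 hΔ X
  have hl' : (0 : ℝ) < l := by exact_mod_cast hl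
  have hΔ' : (0 : ℝ) < Δ := by exact_mod_cast hΔ0
  rw [div_div, one_div, inv_mul_le_iff₀ (by positivity)]
  calc (#X : ℝ) ≤ l * (1 + (Δ + 1) / α₀) * #(H.mixedEdges l X) := hmixed
    _ ≤ l * (1 + (Δ + 1) / α₀) *
        (Δ * ((H.subdivide l).extNeighborhood (X : Set (H.SubdivVertex l))).ncard) := by gcongr
    _ = _ := by ring

end Expansion

end SimpleGraph

/-! ### Conclusion -/

theorem proposition3 :
    ∃ (c α₀ : ℝ) (Δ : ℕ), 0 < c ∧ 0 < α₀ ∧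
      ∀ k : ℕ, 1 < k → ∀ α : ℝ, 0 < α → α < c / ((k.minFac : ℝ) - 1) →
        ∀ N : ℕ, ∃ (V : Type) (_ : Fintype V) (G : SimpleGraph V),
          N ≤ Fintype.card V ∧
          G.IsExpanding α ∧
          (∀ (v : V) (C : G.Walk v v), C.IsCycle → k.minFac ∣ C.length) ∧
          (∀ r : ℕ, ¬ k.minFac ∣ r →
            ¬ ∃ (v : V) (C : G.Walk v v), C.IsCycle ∧ C.length ≡ r [MOD k]) ∧
          (∃ (m : ℕ) (H : SimpleGraph (Fin m)),
            H.IsExpanding α₀ ∧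
            (∀ v : Fin m, (H.neighborSet v).ncard ≤ Δ) ∧
            Nonempty (G ≃g H.subdivide (k.minFac - 1))) := by
  classical
  refine ⟨1 / ((42 : ℕ) * (1 + ((42 : ℕ) + 1) / (1 / 2))), 1 / 2, 42, by positivity,
    by norm_num, fun k hk α _ hα N => ?_⟩
  -- The subdivision has at least as many vertices as `H`, so `N` vertices of `H` suffice.
  obtain ⟨H, hH, hΔ⟩ := SimpleGraph.exists_isExpanding N
  have hp : 2 ≤ k.minFac := (Nat.minFac_prime hk.ne').two_le
  have hl : 0 < k.minFac - 1 := by omega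
  have hcycle (v) (C : (H.subdivide (k.minFac - 1)).Walk v v) (hC : C.IsCycle) :
      k.minFac ∣ C.length := by
    have := hC.dvd_length_of_subdivide hl
    rwa [Nat.sub_add_cancel (by omega)] at this
  refine ⟨H.SubdivVertex (k.minFac - 1), inferInstance, H.subdivide (k.minFac - 1), ?_, ?_, hcycle,
    ?_, N, H, hH, hΔ, ⟨SimpleGraph.Iso.refl⟩⟩
  · simp
  · refine (hH.subdivide (by norm_num) (by norm_num) hΔ hl).mono ?_
    rw [Nat.cast_sub (by omega), Nat.cast_one]
    exact hα.le
  · rintro r hr ⟨v, C, hC, hmod⟩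
    exact hr ((hmod.of_dvd k.minFac_dvd).dvd_iff dvd_rfl |>.1 (hcycle v C hC))
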